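/- Let $(X,d)$ be a metric space which has bounded geometry (for every $r>0$ the closed balls of radius $r$ have finite, uniformly bounded cardinality) and is strongly discrete (the set $\{d(x,y):x,y\in X\}$ is a discrete subset of $\mathbb{R}$). Write $\beta Y$ for the Stone–Čech compactification (space of ultrafilters) of a discrete set $Y$; closures of subsets of $Y$ are taken in $\beta Y$. For $R>0$ put $E_R=\{(x,y)\in X\times X: d(x,y)\le R\}$, and let $G(X)=\bigcup_{R>0}\overline{E_R}\subseteq\beta(X\times X)$ be the coarse groupoid, with range and source maps $\mathrm{r},\mathrm{s}:G(X)\to\beta X$ extending $(x,y)\mapsto x$ and $(x,y)\mapsto y$. A subset $U\subseteq\beta X$ is invariant if $\mathrm{r}^{-1}(U)=\mathrm{s}^{-1}(U)$ in $G(X)$, and then $G(X)_U:=\mathrm{s}^{-1}(U)$. For a bounded operator $T$ on $\ell^2(X)$ put $T(x,y)=\langle T\delta_y,\delta_x\rangle$, let $\overline T$ be the continuous extension of $(x,y)\mapsto T(x,y)$ to $\beta(X\times X)$, and let $\mathrm{supp}_\varepsilon(T)=\{(x,y):|T(x,y)|\ge\varepsilon\}$. Let $\mathbb{C}_u[X]$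 be the $*$-algebra of operators of finite propagation (those $T$ for which there is $R$ such that $T(x,y)\ne0$ implies $d(x,y)\le R$), and let the uniform Roe algebra $C^*_u(X)$ be its operator norm closure. For a closed two-sided ideal $I$ of $C^*_u(X)$ put \[U(I)=\bigcup_{T\in I,\ \varepsilon>0}\overline{\mathrm{r}(\mathrm{supp}_\varepsilon(T))}\subseteq\beta X .\] For an invariant open set $U\subseteq\beta X$ let $\mathfrak{I}_U$ be the set of all closed two-sided ideals $I$ of $C^*_u(X)$ with $U(I)=U$, ordered by inclusion, let $I(U)$ be the operator norm closure of \[\{T\in\mathbb{C}_u[X]:\overline T(\gamma)=0\text{ for all }\gamma\notin G(X)_U\},\] and let \[\tilde I(U)=\{T\in C^*_u(X):\overline{\mathrm{r}(\mathrm{supp}_\varepsilon(T))}\subseteq U\text{ for all }\varepsilon>0\}.\] Theorem. Let $U$ be an invariant open subset of $\beta X$. Then every closed two-sided ideal $I$ of $C^*_u(X)$ with $U(I)=U$ satisfies $I(U)\subseteq I\subseteq\tilde I(U)$. Moreover $I(U)$ and $\tilde I(U)$ themselves belong to $\mathfrak{I}_U$; thus $I(U)$ (the geometric ideal) is the smallest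 element and $\tilde I(U)$ (the ghostly ideal) is the largest element of $\mathfrak{I}_U$. -/

import Mathlib

open Filter Topology

/-! Coarse-geometric conditions on a metric space. -/

/-- Bounded geometry: for every radius, the cardinalities of the closed balls of this radius are
finite and uniformly bounded. -/
def BoundedGeometry (X : Type*) [MetricSpace X] : Prop :=
  ∀ r : ℝ, 0 < r → ∃ N : ℕ, ∀ x : X, (Metric.closedBall x r).encard ≤ N

/-- Strong discreteness: the set of values of the metric is a discrete subset of `ℝ`. -/
def StronglyDiscrete (X : Type*) [MetricSpace X] : Prop :=
  IsDiscrete (Set.range fun p : X × X => dist p.1 p.2)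

/-! The Stone-Čech compactification of a discrete set and the coarse groupoid. -/

/-- The Stone-Čech compactification of the discrete set `Y`, realised as the space of ultrafilters
on `Y`; the point `y : Y` corresponds to the principal ultrafilter `pure y`. -/
abbrev Beta (Y : Type*) : Type _ := Ultrafilter Y

/-- The closure in `Beta Y` of a subset `A` of `Y`. -/
def betaClosure {Y : Type*} (A : Set Y) : Set (Beta Y) :=
  closure ((fun y => (pure y : Ultrafilter Y)) '' A)

/-- The entourage of width `R`. -/
def entourage (X : Type*) [MetricSpace X] (R : ℝ) : Set (X × X) :=
  {p | dist p.1 p.2 ≤ R}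

/-- The coarse groupoid of `X` as a subset of `Beta (X × X)`. -/
def coarseGroupoid (X : Type*) [MetricSpace X] : Set (Beta (X × X)) :=
  ⋃ (R : ℝ) (_ : 0 < R), betaClosure (entourage X R)

/-- The continuous extension of the first projection: the range map. -/
def rangeMap {X : Type*} (γ : Beta (X × X)) : Beta X := γ.map Prod.fst

/-- The continuous extension of the second projection: the source map. -/
def sourceMap {X : Type*} (γ : Beta (X × X)) : Beta X := γ.map Prod.snd

/-- A set of units is invariant if its preimages in the coarse groupoid under the range and the
source map are the same. -/
def IsInvariantUnits {X : Type*} [MetricSpace X] (U : Set (Beta X)) : Prop :=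
  coarseGroupoid X ∩ rangeMap ⁻¹' U = coarseGroupoid X ∩ sourceMap ⁻¹' U

/-- The reduction of the coarse groupoid to a set of units (used for invariant sets). -/
def coarseGroupoidRestrict {X : Type*} [MetricSpace X] (U : Set (Beta X)) : Set (Beta (X × X)) :=
  coarseGroupoid X ∩ sourceMap ⁻¹' U

/-! Operators on `ℓ²(X)` as matrices, and the uniform Roe algebra. -/

/-- The Hilbert space of square-summable complex functions on `X`. -/
abbrev EllTwo (X : Type*) : Type _ := lp (fun _ : X => ℂ) 2

open scoped Classical in
/-- The basis vector at `x`. -/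
noncomputable def deltaVec {X : Type*} (x : X) : EllTwo X := lp.single 2 x (1 : ℂ)

/-- The matrix coefficient `T(x,y)`, the inner product of `T δ_y` with `δ_x` (linear in
`T δ_y`; Mathlib's inner product is linear in its second vector). -/
noncomputable def entry {X : Type*} (T : EllTwo X →L[ℂ] EllTwo X) (x y : X) : ℂ :=
  inner ℂ (deltaVec x) (T (deltaVec y))

theorem entry_eq {X : Type*} (T : EllTwo X →L[ℂ] EllTwo X) (x y : X) :
    entry T x y = T (deltaVec y) x := by
  classical
  rw [entry, deltaVec, lp.inner_single_left]
  simp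

theorem norm_deltaVec {X : Type*} (x : X) : ‖deltaVec x‖ = 1 := by
  classical
  rw [deltaVec, lp.norm_single (by norm_num)]
  simp

theorem norm_entry_le {X : Type*} (T : EllTwo X →L[ℂ] EllTwo X) (x y : X) :
    ‖entry T x y‖ ≤ ‖T‖ := by
  have h1 := norm_inner_le_norm (𝕜 := ℂ) (deltaVec x) (T (deltaVec y))
  have h2 := T.le_opNorm (deltaVec y)
  rw [norm_deltaVec, one_mul] at h1
  rw [norm_deltaVec, mul_one] at h2
  exact h1.trans h2

theorem entry_star {X : Type*} (T : EllTwo X →L[ℂ] EllTwo X) (x y : X) :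
    entry (star T) x y = star (entry T y x) := by
  rw [entry, entry, ContinuousLinearMap.star_eq_adjoint, ContinuousLinearMap.adjoint_inner_right,
    ← inner_conj_symm]
  rfl

/-- A non-zero coefficient of a product comes from non-zero coefficients of the factors. -/
theorem exists_entry_ne_zero {X : Type*} (S T : EllTwo X →L[ℂ] EllTwo X) (x y : X)
    (h : entry (S * T) x y ≠ 0) : ∃ z, entry S x z ≠ 0 ∧ entry T z y ≠ 0 := by
  by_contra! hc
  apply h
  have e : entry (S * T) x y = inner ℂ (star S (deltaVec x)) (T (deltaVec y)) := by
    rw [entry, ContinuousLinearMap.star_eq_adjoint, ContinuousLinearMap.adjoint_inner_left]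
    rfl
  rw [e, lp.inner_eq_tsum]
  refine (tsum_congr fun z => ?_).trans tsum_zero
  rw [← entry_eq, ← entry_eq, entry_star]
  by_cases hz : entry S x z = 0
  · simp [hz]
  · simp [hc z hz]

/-- The propagation of `T` is at most `R`. -/
def PropagationLE {X : Type*} [MetricSpace X] (T : EllTwo X →L[ℂ] EllTwo X) (R : ℝ) : Prop :=
  ∀ x y : X, entry T x y ≠ 0 → dist x y ≤ R

/-- The algebraic uniform Roe algebra: all operators of finite propagation. -/
noncomputable def algUniformRoe (X : Type*) [MetricSpace X] :
    StarSubalgebra ℂ (EllTwo X →L[ℂ] EllTwo X) where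
  carrier := {T | ∃ R : ℝ, PropagationLE T R}
  mul_mem' := by
    rintro S T ⟨R, hR⟩ ⟨R', hR'⟩
    refine ⟨R + R', fun x y h => ?_⟩
    obtain ⟨z, h1, h2⟩ := exists_entry_ne_zero S T x y h
    exact (dist_triangle x z y).trans (add_le_add (hR _ _ h1) (hR' _ _ h2))
  add_mem' := by
    rintro S T ⟨R, hR⟩ ⟨R', hR'⟩
    refine ⟨max R R', fun x y h => ?_⟩
    have e : entry (S + T) x y = entry S x y + entry T x y := by
      simp [entry]
    by_cases h1 : entry S x y = 0
    · exact le_max_of_le_right (hR' _ _ fun h2 => h (by rw [e, h1, h2, add_zero]))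
    · exact le_max_of_le_left (hR _ _ h1)
  algebraMap_mem' := by
    intro c
    refine ⟨0, fun x y h => ?_⟩
    by_contra hxy
    have hne : x ≠ y := by
      rintro rfl
      simp at hxy
    apply h
    classical
    rw [entry_eq, Algebra.algebraMap_eq_smul_one]
    simp [deltaVec, lp.single_apply, hne]
  star_mem' := by
    rintro T ⟨R, hR⟩
    refine ⟨R, fun x y h => ?_⟩
    rw [dist_comm]
    refine hR _ _ fun h0 => h ?_
    rw [entry_star, h0, star_zero]

/-- The uniform Roe algebra: the operator norm closure of the finite propagation operators. -/
noncomputable def uniformRoe (X : Type*) [MetricSpace X] :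
    StarSubalgebra ℂ (EllTwo X →L[ℂ] EllTwo X) :=
  (algUniformRoe X).topologicalClosure

/-! Ideals and invariant open sets. -/

/-- The `ε`-support of an operator. -/
def epsSupport {X : Type*} (T : EllTwo X →L[ℂ] EllTwo X) (ε : ℝ) : Set (X × X) :=
  {p | ε ≤ ‖entry T p.1 p.2‖}

/-- The set of units attached to an ideal (given by its set of elements) of the uniform Roe
algebra: the union of the closures of the ranges of the `ε`-supports of its elements. -/
def unitsOf {X : Type*} [MetricSpace X] (I : Set (uniformRoe X)) : Set (Beta X) :=
  ⋃ T ∈ I, ⋃ (ε : ℝ) (_ : 0 < ε),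
    betaClosure (Prod.fst '' epsSupport (T : EllTwo X →L[ℂ] EllTwo X) ε)

/-- The continuous extension to `Beta (X × X)` of the bounded function `(x, y) ↦ T(x,y)`; its
value at `γ` is the limit of the function along the ultrafilter `γ`. -/
noncomputable def betaExtend {X : Type*} (T : EllTwo X →L[ℂ] EllTwo X) (γ : Beta (X × X)) : ℂ :=
  limUnder (γ : Filter (X × X)) fun p => entry T p.1 p.2

/-- The limit in the definition of `betaExtend` exists. -/
theorem tendsto_betaExtend {X : Type*} (T : EllTwo X →L[ℂ] EllTwo X) (γ : Beta (X × X)) :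
    Tendsto (fun p : X × X => entry T p.1 p.2) γ (𝓝 (betaExtend T γ)) := by
  apply tendsto_nhds_limUnder
  have hc : IsCompact (Metric.closedBall (0 : ℂ) ‖T‖) := isCompact_closedBall _ _
  obtain ⟨c, -, hle⟩ := hc.ultrafilter_le_nhds (γ.map fun p => entry T p.1 p.2) (by
    refine le_principal_iff.2 (Filter.mem_map.2 (Filter.univ_mem' fun p => ?_))
    exact mem_closedBall_zero_iff.2 (norm_entry_le T _ _))
  exact ⟨c, hle⟩

/-- `betaExtend T` does extend the matrix of `T`. -/
theorem betaExtend_pure {X : Type*} (T : EllTwo X →L[ℂ] EllTwo X) (p : X × X) :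
    betaExtend T (pure p) = entry T p.1 p.2 := by
  have h := tendsto_betaExtend T (pure p)
  rw [Ultrafilter.coe_pure] at h
  exact tendsto_nhds_unique h (tendsto_pure_nhds _ _)

/-- `betaExtend T` is continuous. -/
theorem continuous_betaExtend {X : Type*} (T : EllTwo X →L[ℂ] EllTwo X) :
    Continuous (betaExtend T) := by
  rw [continuous_iff_continuousAt]
  intro γ
  refine (Metric.nhds_basis_closedBall.tendsto_right_iff).2 fun ε hε => ?_
  have h := tendsto_betaExtend T γ (Metric.closedBall_mem_nhds _ hε)
  have hopen := (ultrafilter_isOpen_basic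
    ((fun p : X × X => entry T p.1 p.2) ⁻¹' Metric.closedBall (betaExtend T γ) ε)).mem_nhds h
  filter_upwards [hopen] with γ' h'
  exact Metric.isClosed_closedBall.mem_of_tendsto (tendsto_betaExtend T γ') h'

/-- The finite propagation operators whose extended matrix vanishes off the reduction of the
coarse groupoid to `U`. -/
def algGeometricIdeal {X : Type*} [MetricSpace X] (U : Set (Beta X)) : Set (uniformRoe X) :=
  {T | (T : EllTwo X →L[ℂ] EllTwo X) ∈ algUniformRoe X ∧
    ∀ γ : Beta (X × X), γ ∉ coarseGroupoidRestrict U → betaExtend T.1 γ = 0}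

/-- The geometric ideal `I(U)`, the norm closure of `algGeometricIdeal U`. -/
def geometricIdeal {X : Type*} [MetricSpace X] (U : Set (Beta X)) : Set (uniformRoe X) :=
  closure (algGeometricIdeal U)

/-- The ghostly ideal `Ĩ(U)`. -/
def ghostlyIdeal {X : Type*} [MetricSpace X] (U : Set (Beta X)) : Set (uniformRoe X) :=
  {T | ∀ ε : ℝ, 0 < ε →
    betaClosure (Prod.fst '' epsSupport (T : EllTwo X →L[ℂ] EllTwo X) ε) ⊆ U}

/-- The closed two-sided ideals (as sets, ordered by inclusion) of the uniform Roe algebra whose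
associated set of units is `U`. -/
def idealsOver {X : Type*} [MetricSpace X] (U : Set (Beta X)) : Set (Set (uniformRoe X)) :=
  {S | (∃ I : TwoSidedIdeal (uniformRoe X), (I : Set (uniformRoe X)) = S) ∧
    IsClosed S ∧ unitsOf S = U}

/-! Matrix coefficients. -/

/-! The upper bound is formal: `unitsOf I ⊆ U` and `I ⊆ ghostlyIdeal U` are the same condition. What
has to be shown is that `ghostlyIdeal U` is a closed ideal. It is closed because matrix coefficients
are 1-Lipschitz in the operator norm. Multiplication by an operator of propagation `R` moves the
range of an ε-support, after shrinking ε, by at most `R`, and an invariant `U` absorbs such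
thickenings (`IsInvariantUnits.betaClosure_thickening_subset`).

For the lower bound, indicator functions are recovered from a closed ideal `I`. If `T ∈ I`, then `T
* star T ∈ I`, and so is its diagonal part (`diagRoe_entry_mem`, by averaging over a colouring).
This diagonal is at least `ε ^ 2` on the range of the ε-support of `T`, so dividing by it there puts
the indicator of that range in `I`. Compactness extends this to every `A` with `betaClosure A ⊆
unitsOf I`. A finite propagation `T` in `algGeometricIdeal U` is then the norm limit of its
truncations to the rows in the range of its δ-support: the remainder has small entries and bounded
propagation, hence small norm by the Schur test.

Both extremal ideals have all of `U` as units because the open set `U` is a union of closures of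
sets `A` whose indicators lie in the geometric ideal. -/

theorem entry_add {X : Type*} (S T : EllTwo X →L[ℂ] EllTwo X) (x y : X) :
    entry (S + T) x y = entry S x y + entry T x y := by
  simp [entry]

theorem entry_sub {X : Type*} (S T : EllTwo X →L[ℂ] EllTwo X) (x y : X) :
    entry (S - T) x y = entry S x y - entry T x y := by
  simp [entry]

theorem entry_sum {X ι : Type*} (s : Finset ι) (T : ι → EllTwo X →L[ℂ] EllTwo X) (x y : X) :
    entry (∑ i ∈ s, T i) x y = ∑ i ∈ s, entry (T i) x y := by
  simp [entry]

theorem hasSum_apply {X : Type*} (T : EllTwo X →L[ℂ] EllTwo X) (ξ : EllTwo X) (x : X) :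
    HasSum (fun y => entry T x y * ξ y) (T ξ x) := by
  classical
  have e : T ξ x = inner ℂ (star T (deltaVec x)) ξ := by
    rw [ContinuousLinearMap.star_eq_adjoint, ContinuousLinearMap.adjoint_inner_left, deltaVec,
      lp.inner_single_left]
    simp
  rw [e]
  refine (lp.hasSum_inner (star T (deltaVec x)) ξ).congr_fun fun y => ?_
  rw [← entry_eq, entry_star]
  simp [mul_comm]

theorem hasSum_entry_mul {X : Type*} (S T : EllTwo X →L[ℂ] EllTwo X) (x y : X) :
    HasSum (fun z => entry S x z * entry T z y) (entry (S * T) x y) := by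
  simp only [entry_eq _ _ y]
  exact hasSum_apply S (T (deltaVec y)) x

theorem entry_ext {X : Type*} {S T : EllTwo X →L[ℂ] EllTwo X}
    (h : ∀ x y, entry S x y = entry T x y) : S = T := by
  ext ξ x
  have hS := hasSum_apply S ξ x
  simp only [h] at hS
  exact hS.unique (hasSum_apply T ξ x)

/-- A large coefficient of a product with at most `N` non-zero summands comes from a large
summand. -/
theorem exists_le_norm_entry_mul {X : Type*} {S T : EllTwo X →L[ℂ] EllTwo X} {x y : X}
    {F : Finset X} {N : ℕ} {ε : ℝ} (hε : 0 < ε) (hF : ∀ z ∉ F, entry S x z * entry T z y = 0)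
    (hN : F.card ≤ N) (h : ε ≤ ‖entry (S * T) x y‖) :
    ∃ z ∈ F, ε / N ≤ ‖entry S x z‖ * ‖entry T z y‖ := by
  by_contra! hc
  have e := (hasSum_entry_mul S T x y).unique (hasSum_sum_of_ne_finset_zero hF)
  rw [e] at h
  rcases F.eq_empty_or_nonempty with rfl | hne
  · simp at h
    linarith
  have hN0 : (0 : ℝ) < N := by exact_mod_cast hne.card_pos.trans_le hN
  have h1 : ∑ z ∈ F, ‖entry S x z * entry T z y‖ < ∑ _z ∈ F, ε / N :=
    Finset.sum_lt_sum_of_nonempty hne fun z hz => by rw [norm_mul]; exact hc z hz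
  rw [Finset.sum_const, nsmul_eq_mul] at h1
  have h2 : (F.card : ℝ) * (ε / N) ≤ N * (ε / N) := by gcongr
  rw [mul_div_cancel₀ _ hN0.ne'] at h2
  exact absurd (h.trans (norm_sum_le _ _)) (by linarith)

/-! Diagonal operators. -/

theorem memlp_mul_of_bound {X : Type*} {f : X → ℂ} {C : ℝ} (hf : ∀ x, ‖f x‖ ≤ C) (ξ : EllTwo X) :
    Memℓp (fun x => f x * ξ x) 2 :=
  ((lp.memℓp ξ).norm.const_mul C).mono fun x => by
    rw [norm_mul]
    exact mul_le_mul_of_nonneg_right (hf x) (norm_nonneg _)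

/-- The set `t` may differ from `s`: diagonal operators use `t = s`, whereas the Schur test needs a
neighbourhood of `s`. -/
theorem norm_le_of_coordinates {X : Type*} {C : ℝ} (hC : 0 ≤ C) {ξ η : EllTwo X}
    (h : ∀ s : Finset X, ∃ t : Finset X, ∑ x ∈ s, ‖η x‖ ^ 2 ≤ C ^ 2 * ∑ x ∈ t, ‖ξ x‖ ^ 2) :
    ‖η‖ ≤ C * ‖ξ‖ := by
  refine lp.norm_le_of_forall_sum_le (by norm_num) (by positivity) fun s => ?_
  obtain ⟨t, ht⟩ := h s
  have h2 := lp.sum_rpow_le_norm_rpow (p := 2) (by norm_num) ξ t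
  simp only [ENNReal.toReal_ofNat, Real.rpow_ofNat] at h2 ⊢
  rw [mul_pow]
  exact ht.trans (mul_le_mul_of_nonneg_left h2 (sq_nonneg C))

open scoped Classical in
/-- Multiplication by a bounded function; zero if the function is unbounded. -/
noncomputable def diagOp {X : Type*} (f : X → ℂ) : EllTwo X →L[ℂ] EllTwo X :=
  if h : ∃ C : ℝ, ∀ x, ‖f x‖ ≤ C then
    LinearMap.mkContinuousOfExistsBound
      { toFun := fun ξ => ⟨fun x => f x * ξ x, memlp_mul_of_bound h.choose_spec ξ⟩
        map_add' := fun ξ η => by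
          ext x
          exact mul_add _ _ _
        map_smul' := fun c ξ => by
          ext x
          exact mul_left_comm _ _ _ }
      -- For empty `X` the chosen bound may be negative.
      ⟨max h.choose 0, fun ξ => norm_le_of_coordinates (le_max_right _ _) fun s => ⟨s, by
        rw [Finset.mul_sum]
        refine Finset.sum_le_sum fun x _ => ?_
        rw [← mul_pow]
        refine pow_le_pow_left₀ (norm_nonneg _) ?_ 2
        refine (norm_mul_le _ _).trans (mul_le_mul_of_nonneg_right ?_ (norm_nonneg _))
        exact (h.choose_spec x).trans (le_max_left _ _)⟩⟩
  else 0

theorem diagOp_apply {X : Type*} {f : X → ℂ} {C : ℝ} (hf : ∀ x, ‖f x‖ ≤ C) (ξ : EllTwo X)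
    (x : X) : diagOp f ξ x = f x * ξ x := by
  rw [diagOp, dif_pos ⟨C, hf⟩]
  rfl

theorem norm_diagOp_le {X : Type*} {f : X → ℂ} {C : ℝ} (hC : 0 ≤ C) (hf : ∀ x, ‖f x‖ ≤ C) :
    ‖diagOp f‖ ≤ C := by
  refine ContinuousLinearMap.opNorm_le_bound _ hC fun ξ => norm_le_of_coordinates hC fun s =>
    ⟨s, ?_⟩
  rw [Finset.mul_sum]
  refine Finset.sum_le_sum fun x _ => ?_
  rw [← mul_pow, diagOp_apply hf]
  refine pow_le_pow_left₀ (norm_nonneg _) ?_ 2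
  exact (norm_mul_le _ _).trans (mul_le_mul_of_nonneg_right (hf x) (norm_nonneg _))

open scoped Classical in
theorem deltaVec_apply {X : Type*} (x y : X) : deltaVec x y = if y = x then 1 else 0 := by
  rw [deltaVec, lp.single_apply, Pi.single_apply]

open scoped Classical in
theorem entry_diagOp {X : Type*} {f : X → ℂ} {C : ℝ} (hf : ∀ x, ‖f x‖ ≤ C) (x y : X) :
    entry (diagOp f) x y = if x = y then f x else 0 := by
  rw [entry_eq, diagOp_apply hf, deltaVec_apply]
  simp

theorem entry_diagOp_mul {X : Type*} {f : X → ℂ} {C : ℝ} (hf : ∀ x, ‖f x‖ ≤ C)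
    (T : EllTwo X →L[ℂ] EllTwo X) (x y : X) :
    entry (diagOp f * T) x y = f x * entry T x y := by
  rw [entry_eq, entry_eq]
  exact diagOp_apply hf _ x

theorem entry_mul_diagOp {X : Type*} {f : X → ℂ} {C : ℝ} (hf : ∀ x, ‖f x‖ ≤ C)
    (T : EllTwo X →L[ℂ] EllTwo X) (x y : X) :
    entry (T * diagOp f) x y = entry T x y * f y := by
  classical
  have e := (hasSum_entry_mul T (diagOp f) x y).unique
    (hasSum_sum_of_ne_finset_zero (s := {y}) fun z hz => by
      rw [entry_diagOp hf, if_neg (by simpa using hz), mul_zero])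
  rw [e, Finset.sum_singleton, entry_diagOp hf, if_pos rfl]

theorem diagOp_mul_diagOp {X : Type*} {f g : X → ℂ} {C D : ℝ} (hf : ∀ x, ‖f x‖ ≤ C)
    (hg : ∀ x, ‖g x‖ ≤ D) : diagOp f * diagOp g = diagOp fun x => f x * g x := by
  have hfg : ∀ x, ‖f x * g x‖ ≤ C * D := fun x =>
    (norm_mul_le _ _).trans
      (mul_le_mul (hf x) (hg x) (norm_nonneg _) ((norm_nonneg _).trans (hf x)))
  refine entry_ext fun x y => ?_
  rw [entry_diagOp_mul hf, entry_diagOp hg, entry_diagOp hfg]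
  split_ifs <;> simp

theorem diagOp_add {X : Type*} {f g : X → ℂ} {C D : ℝ} (hf : ∀ x, ‖f x‖ ≤ C)
    (hg : ∀ x, ‖g x‖ ≤ D) : diagOp f + diagOp g = diagOp fun x => f x + g x := by
  have hfg : ∀ x, ‖f x + g x‖ ≤ C + D := fun x =>
    (norm_add_le _ _).trans (add_le_add (hf x) (hg x))
  refine entry_ext fun x y => ?_
  rw [entry_add, entry_diagOp hf, entry_diagOp hg, entry_diagOp hfg]
  split_ifs <;> simp

theorem diagOp_sub {X : Type*} {f g : X → ℂ} {C D : ℝ} (hf : ∀ x, ‖f x‖ ≤ C)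
    (hg : ∀ x, ‖g x‖ ≤ D) : diagOp f - diagOp g = diagOp fun x => f x - g x := by
  have hfg : ∀ x, ‖f x - g x‖ ≤ C + D := fun x =>
    (norm_sub_le _ _).trans (add_le_add (hf x) (hg x))
  refine entry_ext fun x y => ?_
  rw [entry_sub, entry_diagOp hf, entry_diagOp hg, entry_diagOp hfg]
  split_ifs <;> simp

theorem diagOp_mem_algUniformRoe {X : Type*} [MetricSpace X] (f : X → ℂ) :
    diagOp f ∈ algUniformRoe X := by
  classical
  refine ⟨0, fun x y h => ?_⟩
  by_cases hf : ∃ C : ℝ, ∀ x, ‖f x‖ ≤ C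
  · obtain ⟨C, hf⟩ := hf
    rw [entry_diagOp hf] at h
    simp only [ne_eq, ite_eq_right_iff, Classical.not_imp] at h
    simp [h.1]
  · simp [diagOp, hf, entry] at h

/-- Multiplication by a bounded function as an element of the uniform Roe algebra. -/
noncomputable def diagRoe {X : Type*} [MetricSpace X] (f : X → ℂ) : uniformRoe X :=
  ⟨diagOp f, (algUniformRoe X).le_topologicalClosure (diagOp_mem_algUniformRoe f)⟩

theorem coe_diagRoe {X : Type*} [MetricSpace X] (f : X → ℂ) :
    (diagRoe f : EllTwo X →L[ℂ] EllTwo X) = diagOp f := rfl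

theorem exists_algUniformRoe_near {X : Type*} [MetricSpace X] (T : uniformRoe X) {δ : ℝ}
    (hδ : 0 < δ) : ∃ S : uniformRoe X, (S : EllTwo X →L[ℂ] EllTwo X) ∈ algUniformRoe X ∧
      ‖T - S‖ < δ := by
  have h : (T : EllTwo X →L[ℂ] EllTwo X) ∈ closure (algUniformRoe X : Set _) := by
    rw [← StarSubalgebra.topologicalClosure_coe]
    exact T.2
  obtain ⟨S, hS, hd⟩ := Metric.mem_closure_iff.1 h δ hδ
  refine ⟨⟨S, (algUniformRoe X).le_topologicalClosure hS⟩, hS, ?_⟩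
  rw [dist_eq_norm] at hd
  exact hd

/-! Consequences of bounded geometry. -/

theorem BoundedGeometry.exists_finset_ball {X : Type*} [MetricSpace X] (hbg : BoundedGeometry X)
    (R : ℝ) : ∃ (N : ℕ) (B : X → Finset X), (∀ x z, z ∈ B x ↔ dist x z ≤ R) ∧
      ∀ x, (B x).card ≤ N := by
  classical
  -- Bounded geometry speaks of positive radii only, while `R` is arbitrary.
  obtain ⟨N, hN⟩ := hbg (max R 1) (by positivity)
  have hsub : ∀ x : X, {z | dist x z ≤ R}.encard ≤ N := fun x =>
    (Set.encard_le_encard fun z hz => by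
      rw [Metric.mem_closedBall, dist_comm]
      exact le_max_of_le_left hz).trans (hN x)
  have hfin : ∀ x : X, {z | dist x z ≤ R}.Finite := fun x => Set.finite_of_encard_le_coe (hsub x)
  refine ⟨N, fun x => (hfin x).toFinset, fun x z => by simp, fun x => ?_⟩
  have h := hsub x
  rw [(hfin x).encard_eq_coe_toFinset_card] at h
  exact_mod_cast h

/-- Schur test: an operator of propagation at most `R` is bounded by a multiple of the supremum
of its coefficients, the factor depending on `R` only. -/
theorem BoundedGeometry.exists_norm_le_of_entry_le {X : Type*} [MetricSpace X]
    (hbg : BoundedGeometry X) (R : ℝ) : ∃ N : ℕ, ∀ (T : EllTwo X →L[ℂ] EllTwo X) (ε : ℝ),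
      0 ≤ ε → PropagationLE T R → (∀ x y, ‖entry T x y‖ ≤ ε) → ‖T‖ ≤ N * ε := by
  classical
  obtain ⟨N, B, hB, hN⟩ := hbg.exists_finset_ball R
  refine ⟨N, fun T ε hε hT hent => ?_⟩
  refine ContinuousLinearMap.opNorm_le_bound _ (by positivity) fun ξ =>
    norm_le_of_coordinates (by positivity) fun s => ⟨s.biUnion B, ?_⟩
  have hrow : ∀ x, ‖T ξ x‖ ^ 2 ≤ N * ε ^ 2 * ∑ y ∈ B x, ‖ξ y‖ ^ 2 := fun x => by
    have e : T ξ x = ∑ y ∈ B x, entry T x y * ξ y :=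
      (hasSum_apply T ξ x).unique (hasSum_sum_of_ne_finset_zero fun y hy => by
        rw [not_not.1 fun h => hy ((hB x y).2 (hT x y h)), zero_mul])
    have h1 : ‖T ξ x‖ ≤ ∑ y ∈ B x, ε * ‖ξ y‖ := by
      rw [e]
      refine (norm_sum_le _ _).trans (Finset.sum_le_sum fun y _ => ?_)
      rw [norm_mul]
      exact mul_le_mul_of_nonneg_right (hent x y) (norm_nonneg _)
    calc ‖T ξ x‖ ^ 2 ≤ (∑ y ∈ B x, ε * ‖ξ y‖) ^ 2 := by gcongr
      _ ≤ (B x).card * ∑ y ∈ B x, (ε * ‖ξ y‖) ^ 2 := sq_sum_le_card_mul_sum_sq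
      _ ≤ N * ∑ y ∈ B x, (ε * ‖ξ y‖) ^ 2 := by
        gcongr
        exact hN x
      _ = N * ε ^ 2 * ∑ y ∈ B x, ‖ξ y‖ ^ 2 := by
        simp only [mul_pow, ← Finset.mul_sum, mul_assoc]
  -- Double counting: by symmetry of the distance, each `y` lies in `B x` for at most `N` points
  -- `x`.
  have hdc : ∑ x ∈ s, ∑ y ∈ B x, ‖ξ y‖ ^ 2 ≤ N * ∑ y ∈ s.biUnion B, ‖ξ y‖ ^ 2 := by
    rw [Finset.sum_comm' (t' := s.biUnion B) (s' := fun y => s ∩ B y)]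
    · rw [Finset.mul_sum]
      refine Finset.sum_le_sum fun y _ => ?_
      rw [Finset.sum_const, nsmul_eq_mul]
      gcongr
      exact (Finset.card_le_card Finset.inter_subset_right).trans (hN y)
    · intro x y
      simp only [Finset.mem_inter, Finset.mem_biUnion, hB, dist_comm y x]
      grind
  calc ∑ x ∈ s, ‖T ξ x‖ ^ 2 ≤ ∑ x ∈ s, N * ε ^ 2 * ∑ y ∈ B x, ‖ξ y‖ ^ 2 :=
        Finset.sum_le_sum fun x _ => hrow x
    _ = N * ε ^ 2 * ∑ x ∈ s, ∑ y ∈ B x, ‖ξ y‖ ^ 2 := by rw [Finset.mul_sum]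
    _ ≤ N * ε ^ 2 * (N * ∑ y ∈ s.biUnion B, ‖ξ y‖ ^ 2) := by gcongr
    _ = (N * ε) ^ 2 * ∑ y ∈ s.biUnion B, ‖ξ y‖ ^ 2 := by ring

/-- Greedy colouring: `X` is a union of finitely many subsets whose distinct points are more than
`R` apart. -/
theorem BoundedGeometry.exists_coloring {X : Type*} [MetricSpace X] (hbg : BoundedGeometry X)
    (R : ℝ) : ∃ (N : ℕ) (c : X → ℕ), (∀ x, c x ≤ N) ∧
      ∀ x y, x ≠ y → dist x y ≤ R → c x ≠ c y := by
  classical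
  obtain ⟨N, B, hB, hN⟩ := hbg.exists_finset_ball R
  -- Along a well-order of `X`, each point receives the least colour not used by an earlier point
  -- within distance `R`. At most `N` colours are excluded, so one of `0, …, N` is free.
  let wf := (IsWellFounded.wf : WellFounded (WellOrderingRel : X → X → Prop))
  let used : (x : X) → ((y : X) → WellOrderingRel y x → ℕ) → Set ℕ := fun x c =>
    {n | ∃ (y : X) (h : WellOrderingRel y x), dist x y ≤ R ∧ c y h = n}
  let c : X → ℕ := wf.fix fun x c => sInf (used x c)ᶜ
  have hc : ∀ x, c x = sInf (used x fun y _ => c y)ᶜ := fun x => wf.fix_eq _ x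
  have hex : ∀ x, ∃ n ∈ (used x fun y _ => c y)ᶜ, n ≤ N := fun x => by
    have hcard : ((B x).image c).card < (Finset.range (N + 1)).card := by
      rw [Finset.card_range]
      exact Nat.lt_succ_of_le (Finset.card_image_le.trans (hN x))
    obtain ⟨n, hn, hn'⟩ := Finset.exists_mem_notMem_of_card_lt_card hcard
    refine ⟨n, ?_, Nat.lt_succ_iff.1 (Finset.mem_range.1 hn)⟩
    rintro ⟨y, _, hd, rfl⟩
    exact hn' (Finset.mem_image_of_mem c ((hB x y).2 hd))
  have hlt : ∀ x y, WellOrderingRel y x → dist x y ≤ R → c x ≠ c y := fun x y hyx hd he => by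
    obtain ⟨n, hn, -⟩ := hex x
    have h := Nat.sInf_mem ⟨n, hn⟩
    rw [← hc x] at h
    exact h ⟨y, hyx, hd, he.symm⟩
  refine ⟨N, c, fun x => ?_, fun x y hxy hd => ?_⟩
  · obtain ⟨n, hn, hnN⟩ := hex x
    rw [hc x]
    exact (Nat.sInf_le hn).trans hnN
  · rcases trichotomous_of (WellOrderingRel : X → X → Prop) x y with h | h | h
    · exact (hlt y x h (by rwa [dist_comm])).symm
    · exact absurd h hxy
    · exact hlt x y h hd

/-! Closures in the Stone-Čech compactification and invariance. -/

theorem mem_betaClosure {Y : Type*} {A : Set Y} {u : Beta Y} : u ∈ betaClosure A ↔ A ∈ u := by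
  constructor
  · refine fun h => closure_minimal ?_ (ultrafilter_isClosed_basic A) h
    rintro _ ⟨y, hy, rfl⟩
    exact hy
  · intro h
    refine ultrafilterBasis_is_basis.mem_closure_iff.2 ?_
    rintro _ ⟨s, rfl⟩ hs
    obtain ⟨y, hys, hyA⟩ := u.nonempty_of_mem (inter_mem hs h)
    exact ⟨pure y, hys, y, hyA, rfl⟩

theorem betaClosure_mono {Y : Type*} {A B : Set Y} (h : A ⊆ B) : betaClosure A ⊆ betaClosure B :=
  closure_mono (Set.image_mono h)

theorem betaClosure_union {Y : Type*} (A B : Set Y) :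
    betaClosure (A ∪ B) = betaClosure A ∪ betaClosure B := by
  rw [betaClosure, Set.image_union, closure_union]
  rfl

theorem betaClosure_empty {Y : Type*} : betaClosure (∅ : Set Y) = ∅ := by
  simp [betaClosure]

theorem mem_ultrafilter_map_of_mapsTo {Y Z : Type*} {u : Ultrafilter Y} {f : Y → Z} {A : Set Y}
    {B : Set Z} (hA : A ∈ u) (h : ∀ y ∈ A, f y ∈ B) : B ∈ u.map f :=
  Ultrafilter.mem_map.2 (mem_of_superset hA h)

theorem exists_betaClosure_subset {Y : Type*} {U : Set (Beta Y)} (hU : IsOpen U) {u : Beta Y}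
    (hu : u ∈ U) : ∃ A : Set Y, u ∈ betaClosure A ∧ betaClosure A ⊆ U := by
  obtain ⟨_, ⟨A, rfl⟩, hA, hAU⟩ := ultrafilterBasis_is_basis.exists_subset_of_mem_open hu hU
  exact ⟨A, mem_betaClosure.2 hA, fun v hv => hAU (mem_betaClosure.1 hv)⟩

theorem mem_coarseGroupoid_of_entourage {X : Type*} [MetricSpace X] {γ : Beta (X × X)} {R : ℝ}
    (h : entourage X R ∈ γ) : γ ∈ coarseGroupoid X := by
  refine Set.mem_iUnion₂.2 ⟨max R 1, by positivity, mem_betaClosure.2 ?_⟩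
  exact mem_of_superset h fun p hp => le_trans hp (le_max_left R 1)

/-- The sets whose closure lies in an invariant set of units are stable under thickening. -/
theorem IsInvariantUnits.betaClosure_thickening_subset {X : Type*} [MetricSpace X]
    {U : Set (Beta X)} (hinv : IsInvariantUnits U) {A : Set X} (hA : betaClosure A ⊆ U) (R : ℝ) :
    betaClosure {x | ∃ z ∈ A, dist x z ≤ R} ⊆ U := by
  intro u hu
  rw [mem_betaClosure] at hu
  have hf : ∀ x, ∃ z, x ∈ {x | ∃ z ∈ A, dist x z ≤ R} → z ∈ A ∧ dist x z ≤ R := fun x => by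
    by_cases hx : x ∈ {x | ∃ z ∈ A, dist x z ≤ R}
    · obtain ⟨z, hz⟩ := hx
      exact ⟨z, fun _ => hz⟩
    · exact ⟨x, fun h => absurd h hx⟩
  choose f hf using hf
  -- Pushing `u` forward to the graph of `f` gives a groupoid element with range `u` and source in
  -- `betaClosure A`; invariance carries membership in `U` from source to range.
  let γ : Beta (X × X) := u.map fun x => (x, f x)
  have hγ : γ ∈ coarseGroupoid X :=
    mem_coarseGroupoid_of_entourage (R := R) (mem_ultrafilter_map_of_mapsTo hu fun x hx => (hf x hx).2)
  have hs : sourceMap γ ∈ U :=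
    hA (mem_betaClosure.2 (mem_ultrafilter_map_of_mapsTo
      (mem_ultrafilter_map_of_mapsTo (B := Prod.snd ⁻¹' A) hu fun x hx => (hf x hx).1)
      fun _ hp => hp))
  have hr : γ ∈ coarseGroupoid X ∩ rangeMap ⁻¹' U := by
    rw [hinv]
    exact ⟨hγ, hs⟩
  exact hr.2

/-! The ghostly ideal. -/

theorem epsSupport_add_subset {X : Type*} (S T : EllTwo X →L[ℂ] EllTwo X) (ε : ℝ) :
    epsSupport (S + T) ε ⊆ epsSupport S (ε / 2) ∪ epsSupport T (ε / 2) := by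
  intro p hp
  have h1 : ε ≤ ‖entry (S + T) p.1 p.2‖ := hp
  rw [entry_add] at h1
  have h2 := h1.trans (norm_add_le _ _)
  by_cases h : ε / 2 ≤ ‖entry S p.1 p.2‖
  · exact Or.inl h
  · exact Or.inr (show ε / 2 ≤ ‖entry T p.1 p.2‖ by linarith)

theorem epsSupport_subset_of_near {X : Type*} {S T : EllTwo X →L[ℂ] EllTwo X} {ε : ℝ}
    (h : ‖T - S‖ ≤ ε / 2) : epsSupport T ε ⊆ epsSupport S (ε / 2) := by
  intro p hp
  have h1 : ε ≤ ‖entry T p.1 p.2‖ := hp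
  have h2 := norm_entry_le (T - S) p.1 p.2
  rw [entry_sub] at h2
  have h3 := norm_sub_norm_le (entry T p.1 p.2) (entry S p.1 p.2)
  show ε / 2 ≤ ‖entry S p.1 p.2‖
  linarith

theorem isClosed_ghostlyIdeal {X : Type*} [MetricSpace X] (U : Set (Beta X)) :
    IsClosed (ghostlyIdeal U) := by
  refine isClosed_of_closure_subset fun T hT ε hε => ?_
  obtain ⟨S, hS, hd⟩ := Metric.mem_closure_iff.1 hT (ε / 2) (half_pos hε)
  rw [dist_eq_norm] at hd
  exact (betaClosure_mono (Set.image_mono (epsSupport_subset_of_near hd.le))).trans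
    (hS _ (half_pos hε))

theorem zero_mem_ghostlyIdeal {X : Type*} [MetricSpace X] (U : Set (Beta X)) :
    0 ∈ ghostlyIdeal U := by
  intro ε hε
  have h : epsSupport ((0 : uniformRoe X) : EllTwo X →L[ℂ] EllTwo X) ε = ∅ := by
    ext p
    simp [epsSupport, entry, hε]
  rw [h, Set.image_empty, betaClosure_empty]
  exact Set.empty_subset _

theorem add_mem_ghostlyIdeal {X : Type*} [MetricSpace X] {U : Set (Beta X)} {S T : uniformRoe X}
    (hS : S ∈ ghostlyIdeal U) (hT : T ∈ ghostlyIdeal U) : S + T ∈ ghostlyIdeal U := by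
  intro ε hε
  refine (betaClosure_mono (Set.image_mono (epsSupport_add_subset S.1 T.1 ε))).trans ?_
  rw [Set.image_union, betaClosure_union]
  exact Set.union_subset (hS _ (half_pos hε)) (hT _ (half_pos hε))

theorem neg_mem_ghostlyIdeal {X : Type*} [MetricSpace X] {U : Set (Beta X)} {T : uniformRoe X}
    (hT : T ∈ ghostlyIdeal U) : -T ∈ ghostlyIdeal U := by
  intro ε hε
  have h : epsSupport ((-T : uniformRoe X) : EllTwo X →L[ℂ] EllTwo X) ε = epsSupport T.1 ε := by
    ext p
    simp [epsSupport, entry]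
  rw [h]
  exact hT ε hε

/-- A closed set is stable under left multiplication by the uniform Roe algebra as soon as it is
stable under left multiplication by the operators of finite propagation. -/
theorem mul_mem_left_of_isClosed {X : Type*} [MetricSpace X] {J : Set (uniformRoe X)}
    (hJ : IsClosed J) (h : ∀ S T : uniformRoe X, (S : EllTwo X →L[ℂ] EllTwo X) ∈ algUniformRoe X →
      T ∈ J → S * T ∈ J) (S : uniformRoe X) {T : uniformRoe X} (hT : T ∈ J) : S * T ∈ J := by
  rw [← hJ.closure_eq]
  have hS : S ∈ closure {S : uniformRoe X | (S : EllTwo X →L[ℂ] EllTwo X) ∈ algUniformRoe X} := by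
    refine Metric.mem_closure_iff.2 fun ε hε => ?_
    simp only [dist_eq_norm]
    exact exists_algUniformRoe_near S hε
  exact map_mem_closure (f := fun S => S * T) (by fun_prop) hS fun S hS => h S T hS hT

/-- A closed set is stable under right multiplication by the uniform Roe algebra as soon as it is
stable under right multiplication by the operators of finite propagation. -/
theorem mul_mem_right_of_isClosed {X : Type*} [MetricSpace X] {J : Set (uniformRoe X)}
    (hJ : IsClosed J) (h : ∀ S T : uniformRoe X, (S : EllTwo X →L[ℂ] EllTwo X) ∈ algUniformRoe X →
      T ∈ J → T * S ∈ J) (S : uniformRoe X) {T : uniformRoe X} (hT : T ∈ J) : T * S ∈ J := by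
  rw [← hJ.closure_eq]
  have hS : S ∈ closure {S : uniformRoe X | (S : EllTwo X →L[ℂ] EllTwo X) ∈ algUniformRoe X} := by
    refine Metric.mem_closure_iff.2 fun ε hε => ?_
    simp only [dist_eq_norm]
    exact exists_algUniformRoe_near S hε
  exact map_mem_closure (f := fun S => T * S) (by fun_prop) hS fun S hS => h S T hS hT

theorem le_of_div_le_mul {a b c N : ℝ} (hb : b ≤ c) (ha : 0 ≤ a) (hc : 0 < c) {ε : ℝ}
    (h : ε / N ≤ b * a) : ε / N / c ≤ a := by
  rw [div_le_iff₀ hc]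
  exact h.trans (by nlinarith)

/-- For `S` of propagation `R`, a large coefficient of `S * T` at `(x, y)` forces a large
coefficient of `T` at some `(z, y)` with `dist x z ≤ R`. This is where invariance of `U` enters. -/
theorem mul_mem_ghostlyIdeal {X : Type*} [MetricSpace X] (hbg : BoundedGeometry X)
    {U : Set (Beta X)} (hinv : IsInvariantUnits U) (S : uniformRoe X) {T : uniformRoe X}
    (hT : T ∈ ghostlyIdeal U) : S * T ∈ ghostlyIdeal U := by
  refine mul_mem_left_of_isClosed (isClosed_ghostlyIdeal U) (fun S T hS hT ε hε => ?_) S hT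
  obtain ⟨R, hR⟩ := hS
  obtain ⟨N, B, hB, hN⟩ := hbg.exists_finset_ball R
  -- The added `1`, here and in `N + 1`, keeps the denominators positive.
  set c : ℝ := ‖S.1‖ + 1 with hc
  have hc0 : 0 < c := by positivity
  refine (betaClosure_mono ?_).trans (hinv.betaClosure_thickening_subset
    (hT (ε / (N + 1) / c) (by positivity)) R)
  rintro x ⟨⟨x, y⟩, hp, rfl⟩
  obtain ⟨z, hz, hle⟩ := exists_le_norm_entry_mul (S := S.1) (T := T.1) (N := N + 1) hε
    (fun z hz => by rw [not_not.1 fun h => hz ((hB x z).2 (hR x z h)), zero_mul])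
    ((hN x).trans (Nat.le_succ N)) hp
  push_cast at hle
  exact ⟨z, ⟨(z, y), le_of_div_le_mul ((norm_entry_le S.1 x z).trans (by linarith))
    (norm_nonneg _) hc0 hle, rfl⟩, (hB x z).1 hz⟩

/-- Right multiplication leaves the row index `x` in place, so no thickening occurs and invariance
is not needed. -/
theorem ghostlyIdeal_mul_mem {X : Type*} [MetricSpace X] (hbg : BoundedGeometry X)
    {U : Set (Beta X)} (S : uniformRoe X) {T : uniformRoe X}
    (hT : T ∈ ghostlyIdeal U) : T * S ∈ ghostlyIdeal U := by
  refine mul_mem_right_of_isClosed (isClosed_ghostlyIdeal U) (fun S T hS hT ε hε => ?_) S hT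
  obtain ⟨R, hR⟩ := hS
  obtain ⟨N, B, hB, hN⟩ := hbg.exists_finset_ball R
  set c : ℝ := ‖S.1‖ + 1 with hc
  have hc0 : 0 < c := by positivity
  refine (betaClosure_mono ?_).trans (hT (ε / (N + 1) / c) (by positivity))
  rintro x ⟨⟨x, y⟩, hp, rfl⟩
  obtain ⟨z, hz, hle⟩ := exists_le_norm_entry_mul (S := T.1) (T := S.1) (N := N + 1) hε
    (fun z hz => by
      rw [
        not_not.1 fun h : entry S.1 z y ≠ 0 => hz ((hB y z).2 (by rw [dist_comm]; exact hR z y h)),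
        mul_zero])
    ((hN y).trans (Nat.le_succ N)) hp
  push_cast at hle
  rw [mul_comm] at hle
  exact ⟨(x, z), le_of_div_le_mul ((norm_entry_le S.1 z y).trans (by linarith))
    (norm_nonneg _) hc0 hle, rfl⟩

/-! The geometric ideal. -/

/-- A finite propagation operator lies in the algebraic geometric ideal if and only if it lies in
the ghostly ideal. -/
theorem mem_algGeometricIdeal_iff {X : Type*} [MetricSpace X] {U : Set (Beta X)}
    (hinv : IsInvariantUnits U) {T : uniformRoe X} :
    T ∈ algGeometricIdeal U ↔
      (T : EllTwo X →L[ℂ] EllTwo X) ∈ algUniformRoe X ∧ T ∈ ghostlyIdeal U := by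
  refine and_congr_right fun hT => ⟨fun h ε hε u hu => ?_, fun h γ hγ => ?_⟩
  · rw [mem_betaClosure] at hu
    have hf : ∀ x, ∃ y, x ∈ Prod.fst '' epsSupport T.1 ε → (x, y) ∈ epsSupport T.1 ε := fun x => by
      by_cases hx : x ∈ Prod.fst '' epsSupport T.1 ε
      · obtain ⟨⟨x, y⟩, hp, rfl⟩ := hx
        exact ⟨y, fun _ => hp⟩
      · exact ⟨x, fun h => absurd h hx⟩
    choose f hf using hf
    -- The graph of a selection from the ε-support lifts `u` to a `γ` with range `u` along which the
    -- coefficients stay at least `ε` in norm, so the extended matrix does not vanish at `γ`.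
    let γ : Beta (X × X) := u.map fun x => (x, f x)
    have hγ : epsSupport T.1 ε ∈ γ := mem_ultrafilter_map_of_mapsTo hu hf
    have hle : ε ≤ ‖betaExtend T.1 γ‖ :=
      ge_of_tendsto (tendsto_betaExtend T.1 γ).norm hγ
    have hmem : γ ∈ coarseGroupoid X ∩ sourceMap ⁻¹' U := by
      by_contra hn
      rw [h γ hn, norm_zero] at hle
      linarith
    rw [← hinv] at hmem
    exact hmem.2
  · by_contra hne
    have hpos : 0 < ‖betaExtend T.1 γ‖ / 2 := half_pos (norm_pos_iff.2 hne)
    have hev := (tendsto_betaExtend T.1 γ).norm.eventually_const_le (half_lt_self (norm_pos_iff.2 hne))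
    have hsupp : epsSupport T.1 (‖betaExtend T.1 γ‖ / 2) ∈ γ := hev
    obtain ⟨R, hR⟩ := hT
    refine hγ ?_
    rw [coarseGroupoidRestrict, ← hinv]
    refine ⟨mem_coarseGroupoid_of_entourage (R := R) (mem_of_superset hsupp fun p hp => ?_), ?_⟩
    · exact hR _ _ (norm_pos_iff.1 (hpos.trans_le hp))
    · refine h _ hpos (mem_betaClosure.2 (mem_ultrafilter_map_of_mapsTo hsupp fun p hp => ?_))
      exact Set.mem_image_of_mem _ hp

theorem geometricIdeal_subset_ghostlyIdeal {X : Type*} [MetricSpace X] {U : Set (Beta X)}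
    (hinv : IsInvariantUnits U) : geometricIdeal U ⊆ ghostlyIdeal U :=
  closure_minimal (fun _ hT => ((mem_algGeometricIdeal_iff hinv).1 hT).2) (isClosed_ghostlyIdeal U)

theorem exists_twoSidedIdeal_ghostlyIdeal {X : Type*} [MetricSpace X] (hbg : BoundedGeometry X)
    {U : Set (Beta X)} (hinv : IsInvariantUnits U) :
    ∃ I : TwoSidedIdeal (uniformRoe X), (I : Set (uniformRoe X)) = ghostlyIdeal U :=
  ⟨.mk' (ghostlyIdeal U) (zero_mem_ghostlyIdeal U) add_mem_ghostlyIdeal neg_mem_ghostlyIdeal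
    (mul_mem_ghostlyIdeal hbg hinv _) (ghostlyIdeal_mul_mem hbg _), TwoSidedIdeal.coe_mk' ..⟩

/-- Before closure, the geometric ideal consists of the finite propagation elements of the ghostly
ideal, so it inherits the algebraic properties; continuity passes them to the closure. -/
theorem exists_twoSidedIdeal_geometricIdeal {X : Type*} [MetricSpace X] (hbg : BoundedGeometry X)
    {U : Set (Beta X)} (hinv : IsInvariantUnits U) :
    ∃ I : TwoSidedIdeal (uniformRoe X), (I : Set (uniformRoe X)) = geometricIdeal U := by
  refine ⟨.mk' (geometricIdeal U) ?_ ?_ ?_ ?_ ?_, TwoSidedIdeal.coe_mk' ..⟩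
  · exact subset_closure ((mem_algGeometricIdeal_iff hinv).2
      ⟨zero_mem _, zero_mem_ghostlyIdeal U⟩)
  · intro S T hS hT
    refine map_mem_closure₂ continuous_add hS hT fun S hS T hT => ?_
    rw [mem_algGeometricIdeal_iff hinv] at hS hT ⊢
    exact ⟨add_mem hS.1 hT.1, add_mem_ghostlyIdeal hS.2 hT.2⟩
  · intro T hT
    refine map_mem_closure continuous_neg hT fun T hT => ?_
    rw [mem_algGeometricIdeal_iff hinv] at hT ⊢
    exact ⟨neg_mem hT.1, neg_mem_ghostlyIdeal hT.2⟩
  · intro S T hT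
    refine mul_mem_left_of_isClosed isClosed_closure (fun S T hS hT => ?_) S hT
    refine map_mem_closure (f := fun T => S * T) (by fun_prop) hT fun T hT => ?_
    rw [mem_algGeometricIdeal_iff hinv] at hT ⊢
    exact ⟨mul_mem hS hT.1, mul_mem_ghostlyIdeal hbg hinv S hT.2⟩
  · intro T S hT
    refine mul_mem_right_of_isClosed isClosed_closure (fun S T hS hT => ?_) S hT
    refine map_mem_closure (f := fun T => T * S) (by fun_prop) hT fun T hT => ?_
    rw [mem_algGeometricIdeal_iff hinv] at hT ⊢
    exact ⟨mul_mem hT.1 hS, ghostlyIdeal_mul_mem hbg S hT.2⟩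

/-! Indicator functions and the units of an ideal. -/

/-- Multiplication by the indicator function of a set. -/
noncomputable def indRoe {X : Type*} [MetricSpace X] (A : Set X) : uniformRoe X :=
  diagRoe (A.indicator 1)

theorem norm_indicator_one_le {X : Type*} (A : Set X) (x : X) :
    ‖A.indicator (1 : X → ℂ) x‖ ≤ 1 := by
  by_cases h : x ∈ A <;> simp [h]

theorem epsSupport_indRoe {X : Type*} [MetricSpace X] (A : Set X) {ε : ℝ} (hε : 0 < ε) :
    Prod.fst '' epsSupport (indRoe A : EllTwo X →L[ℂ] EllTwo X) ε ⊆ A := by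
  classical
  rintro _ ⟨⟨x, y⟩, hp, rfl⟩
  have h : ε ≤ ‖entry (diagOp (A.indicator 1)) x y‖ := hp
  rw [entry_diagOp (norm_indicator_one_le A)] at h
  by_contra hx
  simp only [Set.indicator_of_notMem hx, ite_self, norm_zero] at h
  linarith

theorem subset_epsSupport_indRoe {X : Type*} [MetricSpace X] (A : Set X) :
    A ⊆ Prod.fst '' epsSupport (indRoe A : EllTwo X →L[ℂ] EllTwo X) 1 := by
  classical
  intro x hx
  refine ⟨(x, x), ?_, rfl⟩
  show 1 ≤ ‖entry (diagOp (A.indicator 1)) x x‖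
  rw [entry_diagOp (norm_indicator_one_le A)]
  simp [hx]

theorem unitsOf_mono {X : Type*} [MetricSpace X] {I J : Set (uniformRoe X)} (h : I ⊆ J) :
    unitsOf I ⊆ unitsOf J :=
  Set.biUnion_subset_biUnion_left h

/-- A point of the open set `U` has a basic neighbourhood `betaClosure A ⊆ U`, and the indicator of
`A` is a diagonal element of the geometric ideal. -/
theorem subset_unitsOf_geometricIdeal {X : Type*} [MetricSpace X] {U : Set (Beta X)}
    (hU : IsOpen U) (hinv : IsInvariantUnits U) : U ⊆ unitsOf (geometricIdeal U) := by
  intro u hu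
  obtain ⟨A, huA, hA⟩ := exists_betaClosure_subset hU hu
  refine Set.mem_iUnion₂.2 ⟨indRoe A, subset_closure ((mem_algGeometricIdeal_iff hinv).2
    ⟨diagOp_mem_algUniformRoe _, fun ε hε =>
      (betaClosure_mono (epsSupport_indRoe A hε)).trans hA⟩), ?_⟩
  exact Set.mem_iUnion₂.2 ⟨1, one_pos, betaClosure_mono (subset_epsSupport_indRoe A) huA⟩

theorem unitsOf_subset_iff {X : Type*} [MetricSpace X] {I : Set (uniformRoe X)}
    {U : Set (Beta X)} : unitsOf I ⊆ U ↔ I ⊆ ghostlyIdeal U := by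
  simp only [unitsOf, Set.iUnion_subset_iff]
  rfl

/-! The diagonal part of an element of a closed ideal. -/

/-- Averaging over roots of unity: the matrix of the equivalence relation given by a finite
colouring is an average of rank one matrices with unimodular coefficients. -/
theorem exists_sum_mul_eq_ite {X : Type*} {c : X → ℕ} {N : ℕ} (hc : ∀ x, c x ≤ N) :
    ∃ f g : ℕ → X → ℂ, (∀ j x, ‖f j x‖ ≤ ((N : ℝ) + 1)⁻¹) ∧ (∀ j x, ‖g j x‖ ≤ 1) ∧
      ∀ x y, ∑ j ∈ Finset.range (N + 1), f j x * g j y = if c x = c y then 1 else 0 := by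
  obtain ⟨ζ, hζ⟩ : ∃ ζ : ℂ, IsPrimitiveRoot ζ (N + 1) :=
    ⟨_, Complex.isPrimitiveRoot_exp _ N.succ_ne_zero⟩
  have hn : ‖ζ‖ = 1 := Complex.norm_eq_one_of_pow_eq_one hζ.pow_eq_one N.succ_ne_zero
  have hζ0 : ζ ≠ 0 := hζ.ne_zero N.succ_ne_zero
  have hN : (N : ℂ) + 1 ≠ 0 := by exact_mod_cast N.succ_ne_zero
  refine ⟨fun j x => ((N : ℂ) + 1)⁻¹ * (ζ ^ c x) ^ j, fun j y => ((ζ ^ c y)⁻¹) ^ j,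
    fun j x => ?_, fun j x => ?_, fun x y => ?_⟩
  · have : ‖(N : ℂ) + 1‖ = N + 1 := by exact_mod_cast Complex.norm_natCast (N + 1)
    simp [hn, this]
  · simp [hn]
  · simp only [mul_assoc, ← mul_pow, ← Finset.mul_sum]
    split_ifs with h
    · rw [h, mul_inv_cancel₀ (pow_ne_zero _ hζ0)]
      simp [hN]
    -- For different colours, `w` is a nontrivial root of unity of order dividing `N + 1`, so its
    -- geometric sum vanishes.
    · set w := ζ ^ c x * (ζ ^ c y)⁻¹ with hw
      have hw1 : w ≠ 1 := fun h1 => by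
        rw [hw, mul_inv_eq_one₀ (pow_ne_zero _ hζ0)] at h1
        exact h (hζ.pow_inj (Nat.lt_succ_of_le (hc x)) (Nat.lt_succ_of_le (hc y)) h1)
      have hwn : w ^ (N + 1) = 1 := by
        rw [hw, mul_pow, inv_pow, pow_right_comm ζ, pow_right_comm ζ (c y), hζ.pow_eq_one]
        simp
      have h2 := mul_geom_sum w (N + 1)
      rw [hwn, sub_self] at h2
      rw [(mul_eq_zero.1 h2).resolve_left (sub_ne_zero.2 hw1), mul_zero]

/-- A closed ideal contains the diagonal parts of its elements. -/
theorem diagRoe_entry_mem {X : Type*} [MetricSpace X] (hbg : BoundedGeometry X)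
    {I : TwoSidedIdeal (uniformRoe X)} (hI : IsClosed (I : Set (uniformRoe X)))
    {T : uniformRoe X} (hT : T ∈ I) : diagRoe (fun x => entry T.1 x x) ∈ I := by
  classical
  change _ ∈ (I : Set (uniformRoe X))
  rw [← hI.closure_eq]
  refine Metric.mem_closure_iff.2 fun ε hε => ?_
  obtain ⟨S, ⟨R, hR⟩, hTS⟩ := exists_algUniformRoe_near T (half_pos hε)
  obtain ⟨N, c, hcN, hc⟩ := hbg.exists_coloring R
  obtain ⟨f, g, hf, hg, hfg⟩ := exists_sum_mul_eq_ite hcN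
  -- `Φ` erases the coefficients between points of different colours. It maps `I` into itself and is
  -- contractive, being an average of two-sided products with diagonal contractions.
  let Φ : uniformRoe X → uniformRoe X := fun A =>
    ∑ j ∈ Finset.range (N + 1), diagRoe (f j) * A * diagRoe (g j)
  have hΦI : Φ T ∈ I := sum_mem fun j _ => I.mul_mem_right _ _ (I.mul_mem_left _ _ hT)
  have hΦentry : ∀ A x y, entry (Φ A).1 x y = if c x = c y then entry A.1 x y else 0 := by
    intro A x y
    have e : (Φ A).1 = ∑ j ∈ Finset.range (N + 1), diagOp (f j) * A.1 * diagOp (g j) := by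
      simp [Φ, coe_diagRoe]
    rw [e, entry_sum]
    simp only [entry_mul_diagOp (hg _), entry_diagOp_mul (hf _)]
    have h2 := congrArg (· * entry A.1 x y) (hfg x y)
    simp only [ite_mul, one_mul, zero_mul, Finset.sum_mul] at h2
    rw [← h2]
    exact Finset.sum_congr rfl fun j _ => by ring
  have hΦnorm : ∀ A : uniformRoe X, ‖Φ A‖ ≤ ‖A‖ := by
    intro A
    have hN : (0 : ℝ) < (N : ℝ) + 1 := by positivity
    have hterm : ∀ j, ‖diagRoe (f j) * A * diagRoe (g j)‖ ≤ ((N : ℝ) + 1)⁻¹ * ‖A‖ := fun j => by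
      have h1 : ‖diagRoe (f j)‖ ≤ ((N : ℝ) + 1)⁻¹ := norm_diagOp_le (by positivity) (hf j)
      have h2 : ‖diagRoe (g j)‖ ≤ 1 := norm_diagOp_le zero_le_one (hg j)
      calc ‖diagRoe (f j) * A * diagRoe (g j)‖
          ≤ ‖diagRoe (f j)‖ * ‖A‖ * ‖diagRoe (g j)‖ :=
            (norm_mul_le _ _).trans (mul_le_mul_of_nonneg_right (norm_mul_le _ _) (norm_nonneg _))
        _ ≤ ((N : ℝ) + 1)⁻¹ * ‖A‖ * 1 := by gcongr
        _ = _ := mul_one _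
    refine (norm_sum_le_of_le _ fun j _ => hterm j).trans ?_
    rw [Finset.sum_const, Finset.card_range, nsmul_eq_mul]
    push_cast
    rw [mul_inv_cancel_left₀ hN.ne']
  have hdiag : ∀ A : uniformRoe X, ∀ x, ‖entry A.1 x x‖ ≤ ‖A‖ := fun A x => norm_entry_le A.1 x x
  have hΦS : Φ S = diagRoe fun x => entry S.1 x x := by
    refine Subtype.ext (entry_ext fun x y => ?_)
    rw [hΦentry, coe_diagRoe, entry_diagOp (hdiag S)]
    by_cases hxy : x = y
    · subst hxy
      simp
    · rw [if_neg hxy]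
      split_ifs with hcc
      -- Distinct points of one colour are more than `R` apart, beyond the propagation of `S`.
      · by_contra hne
        exact hc x y hxy (hR x y hne) hcc
      · rfl
  refine ⟨Φ T, hΦI, ?_⟩
  have h1 : ‖Φ S - Φ T‖ ≤ ‖S - T‖ := by
    have e : Φ S - Φ T = Φ (S - T) := by
      simp only [Φ, mul_sub, sub_mul, Finset.sum_sub_distrib]
    rw [e]
    exact hΦnorm _
  have h2 : ‖diagRoe (fun x => entry T.1 x x) - Φ S‖ ≤ ‖T - S‖ := by
    rw [hΦS]
    change ‖diagOp (fun x => entry T.1 x x) - diagOp fun x => entry S.1 x x‖ ≤ _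
    rw [diagOp_sub (hdiag T) (hdiag S)]
    refine norm_diagOp_le (norm_nonneg _) fun x => ?_
    rw [← entry_sub]
    exact hdiag (T - S) x
  rw [norm_sub_rev S T] at h1
  rw [dist_eq_norm]
  have h3 := norm_sub_le_norm_sub_add_norm_sub (diagRoe fun x => entry T.1 x x) (Φ S) (Φ T)
  linarith

/-! ### Indicator functions in a closed ideal. -/

theorem diagRoe_mul_diagRoe {X : Type*} [MetricSpace X] {f g : X → ℂ} {C D : ℝ}
    (hf : ∀ x, ‖f x‖ ≤ C) (hg : ∀ x, ‖g x‖ ≤ D) :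
    diagRoe f * diagRoe g = diagRoe fun x => f x * g x :=
  Subtype.ext (diagOp_mul_diagOp hf hg)

/-- The diagonal coefficient of `T * star T` at `x` is the sum of the squared moduli along row `x`
of `T`, so no cancellation can hide a large coefficient. -/
theorem sq_norm_entry_le_norm_entry_mul_star {X : Type*} (T : EllTwo X →L[ℂ] EllTwo X) (x y : X) :
    ‖entry T x y‖ ^ 2 ≤ ‖entry (T * star T) x x‖ := by
  have h1 := hasSum_entry_mul T (star T) x x
  have h2 : HasSum (fun z => ((‖entry T x z‖ ^ 2 : ℝ) : ℂ)) (entry (T * star T) x x) :=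
    h1.congr_fun fun z => by
      rw [entry_star]
      push_cast
      exact (Complex.mul_conj' _).symm
  have h3 := Complex.hasSum_re h2
  simp only [Complex.ofReal_re] at h3
  exact (le_hasSum h3 y fun z _ => sq_nonneg _).trans (Complex.re_le_norm _)

/-- For `T` in a closed ideal, the ideal contains the indicator function of the range of the
`ε`-support of `T`. -/
theorem indRoe_epsSupport_mem {X : Type*} [MetricSpace X] (hbg : BoundedGeometry X)
    {I : TwoSidedIdeal (uniformRoe X)} (hI : IsClosed (I : Set (uniformRoe X)))
    {T : uniformRoe X} (hT : T ∈ I) {ε : ℝ} (hε : 0 < ε) :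
    indRoe (Prod.fst '' epsSupport T.1 ε) ∈ I := by
  set A := Prod.fst '' epsSupport T.1 ε with hA
  have hd := diagRoe_entry_mem hbg hI (I.mul_mem_right T (star T) hT)
  set f : X → ℂ := fun x => entry (T * star T : uniformRoe X).1 x x with hf
  have hfA : ∀ x ∈ A, ε ^ 2 ≤ ‖f x‖ := by
    rintro _ ⟨⟨x, y⟩, hp, rfl⟩
    exact (pow_le_pow_left₀ hε.le hp 2).trans (sq_norm_entry_le_norm_entry_mul_star T.1 x y)
  have hg : ∀ x, ‖A.indicator (fun x => (f x)⁻¹) x‖ ≤ (ε ^ 2)⁻¹ := fun x => by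
    by_cases hx : x ∈ A
    · rw [Set.indicator_of_mem hx, norm_inv]
      exact inv_anti₀ (by positivity) (hfA x hx)
    · rw [Set.indicator_of_notMem hx, norm_zero]
      positivity
  have e : indRoe A = diagRoe f * diagRoe (A.indicator fun x => (f x)⁻¹) := by
    rw [diagRoe_mul_diagRoe (fun x => norm_entry_le _ x x) hg, indRoe]
    congr 1
    ext x
    by_cases hx : x ∈ A
    · have h0 : f x ≠ 0 := norm_pos_iff.1 ((by positivity : 0 < ε ^ 2).trans_le (hfA x hx))
      rw [Set.indicator_of_mem hx, Set.indicator_of_mem hx, mul_inv_cancel₀ h0, Pi.one_apply]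
    · simp [hx]
  rw [e]
  exact I.mul_mem_right _ _ hd

theorem indRoe_mul_indRoe {X : Type*} [MetricSpace X] (A B : Set X) :
    indRoe A * indRoe B = indRoe (A ∩ B) := by
  rw [indRoe, indRoe, diagRoe_mul_diagRoe (norm_indicator_one_le A) (norm_indicator_one_le B),
    indRoe]
  congr 1
  ext x
  by_cases hA : x ∈ A <;> by_cases hB : x ∈ B <;> simp [hA, hB]

theorem indRoe_add_indRoe_diff {X : Type*} [MetricSpace X] (A B : Set X) :
    indRoe A + indRoe (B \ A) = indRoe (A ∪ B) := by
  refine Subtype.ext ((diagOp_add (norm_indicator_one_le A) (norm_indicator_one_le _)).trans ?_)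
  change diagOp _ = diagOp _
  congr 1
  ext x
  by_cases hA : x ∈ A <;> by_cases hB : x ∈ B <;> simp [hA, hB]

theorem indRoe_mem_of_subset {X : Type*} [MetricSpace X] {I : TwoSidedIdeal (uniformRoe X)}
    {A B : Set X} (hAB : A ⊆ B) (hB : indRoe B ∈ I) : indRoe A ∈ I := by
  rw [← Set.inter_eq_left.2 hAB, ← indRoe_mul_indRoe]
  exact I.mul_mem_left _ _ hB

theorem indRoe_union_mem {X : Type*} [MetricSpace X] {I : TwoSidedIdeal (uniformRoe X)}
    {A B : Set X} (hA : indRoe A ∈ I) (hB : indRoe B ∈ I) : indRoe (A ∪ B) ∈ I := by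
  rw [← indRoe_add_indRoe_diff]
  exact add_mem hA (indRoe_mem_of_subset Set.sdiff_subset hB)

theorem indRoe_empty {X : Type*} [MetricSpace X] : indRoe (∅ : Set X) = 0 := by
  classical
  refine Subtype.ext (entry_ext fun x y => ?_)
  change entry (diagOp (Set.indicator ∅ 1)) x y = entry 0 x y
  rw [entry_diagOp (norm_indicator_one_le ∅)]
  simp [entry]

/-- A closed ideal contains the indicator functions of all sets whose closure consists of units
of the ideal. -/
theorem indRoe_mem_of_betaClosure_subset {X : Type*} [MetricSpace X] (hbg : BoundedGeometry X)
    {I : TwoSidedIdeal (uniformRoe X)} (hI : IsClosed (I : Set (uniformRoe X))) {A : Set X}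
    (hA : betaClosure A ⊆ unitsOf (I : Set (uniformRoe X))) : indRoe A ∈ I := by
  have hcomp : IsCompact (betaClosure A) := isClosed_closure.isCompact
  obtain ⟨B, hB, hAB⟩ : ∃ B : Set X, indRoe B ∈ I ∧ betaClosure A ⊆ betaClosure B := by
    -- Compactness as induction: the property passes to subsets and finite unions, and holds near
    -- each `u` because closures of subsets of `X` are open.
    refine hcomp.induction_on (p := fun s => ∃ B : Set X, indRoe B ∈ I ∧ s ⊆ betaClosure B)
      ⟨∅, by rw [indRoe_empty]; exact zero_mem I, Set.empty_subset _⟩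
      (fun s t hst ⟨B, hB, ht⟩ => ⟨B, hB, hst.trans ht⟩) ?_ ?_
    · rintro s t ⟨B, hB, hs⟩ ⟨C, hC, ht⟩
      refine ⟨B ∪ C, indRoe_union_mem hB hC, ?_⟩
      rw [betaClosure_union]
      exact Set.union_subset_union hs ht
    · intro u hu
      obtain ⟨T, hT, hu⟩ := Set.mem_iUnion₂.1 (hA hu)
      obtain ⟨ε, hε, hu⟩ := Set.mem_iUnion₂.1 hu
      rw [mem_betaClosure] at hu
      exact ⟨{v | Prod.fst '' epsSupport T.1 ε ∈ v},
        mem_nhdsWithin_of_mem_nhds ((ultrafilter_isOpen_basic _).mem_nhds hu),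
        _, indRoe_epsSupport_mem hbg hI hT hε, fun v hv => mem_betaClosure.2 hv⟩
  -- Testing the inclusion of closures on principal ultrafilters gives `A ⊆ B`.
  refine indRoe_mem_of_subset (fun x hx => ?_) hB
  exact mem_betaClosure.1 (hAB (mem_betaClosure.2 (show A ∈ (pure x : Ultrafilter X) from hx)))

/-! ### Minimality of the geometric ideal and the theorem. -/

theorem algGeometricIdeal_subset {X : Type*} [MetricSpace X] (hbg : BoundedGeometry X)
    {U : Set (Beta X)} (hinv : IsInvariantUnits U) {I : TwoSidedIdeal (uniformRoe X)}
    (hI : IsClosed (I : Set (uniformRoe X))) (hIU : unitsOf (I : Set (uniformRoe X)) = U) :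
    algGeometricIdeal U ⊆ (I : Set (uniformRoe X)) := by
  classical
  intro T hT
  obtain ⟨⟨R, hR⟩, hgh⟩ := (mem_algGeometricIdeal_iff hinv).1 hT
  obtain ⟨N, hN⟩ := hbg.exists_norm_le_of_entry_le R
  rw [← hI.closure_eq]
  refine Metric.mem_closure_iff.2 fun ε hε => ?_
  -- With `N` the Schur constant for propagation `R`, a remainder with entries at most `δ` has norm
  -- at most `N * δ < ε`.
  set δ := ε / (N + 1) with hδ
  have hδ0 : 0 < δ := by positivity
  set A := Prod.fst '' epsSupport T.1 δ with hA
  have hAI : indRoe A ∈ I :=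
    indRoe_mem_of_betaClosure_subset hbg hI (by rw [hIU]; exact hgh δ hδ0)
  refine ⟨indRoe A * T, I.mul_mem_right _ _ hAI, ?_⟩
  have he : ∀ x y, entry (T.1 - diagOp (A.indicator 1) * T.1) x y =
      if x ∈ A then 0 else entry T.1 x y := fun x y => by
    rw [entry_sub, entry_diagOp_mul (norm_indicator_one_le A)]
    split_ifs with h <;> simp [h]
  have hle : ‖T.1 - diagOp (A.indicator 1) * T.1‖ ≤ N * δ := by
    refine hN _ δ hδ0.le (fun x y h => hR x y fun h0 => h ?_) fun x y => ?_
    · rw [he, h0, ite_self]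
    · rw [he]
      split_ifs with h
      · simpa using hδ0.le
      · exact le_of_not_ge fun hge => h ⟨(x, y), hge, rfl⟩
  have hlt : (N : ℝ) * δ < ε := by
    rw [hδ, mul_div_assoc', div_lt_iff₀ (by positivity)]
    nlinarith
  rw [dist_eq_norm]
  exact hle.trans_lt hlt

theorem mainTheorem1 {X : Type*} [MetricSpace X] (hsd : StronglyDiscrete X)
    (hbg : BoundedGeometry X) (U : Set (Beta X)) (hU : IsOpen U) (hinv : IsInvariantUnits U) :
    (∀ I : TwoSidedIdeal (uniformRoe X), IsClosed (I : Set (uniformRoe X)) →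
      unitsOf (I : Set (uniformRoe X)) = U →
        geometricIdeal U ⊆ (I : Set (uniformRoe X)) ∧
          (I : Set (uniformRoe X)) ⊆ ghostlyIdeal U) ∧
    IsLeast (idealsOver U) (geometricIdeal U) ∧
    IsGreatest (idealsOver U) (ghostlyIdeal U) := by
  have hmain : ∀ I : TwoSidedIdeal (uniformRoe X), IsClosed (I : Set (uniformRoe X)) →
      unitsOf (I : Set (uniformRoe X)) = U →
        geometricIdeal U ⊆ (I : Set (uniformRoe X)) ∧
          (I : Set (uniformRoe X)) ⊆ ghostlyIdeal U := fun I hI hIU =>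
    ⟨closure_minimal (algGeometricIdeal_subset hbg hinv hI hIU) hI, unitsOf_subset_iff.1 hIU.subset⟩
  have hsub := geometricIdeal_subset_ghostlyIdeal hinv
  have hunits := subset_unitsOf_geometricIdeal hU hinv
  refine ⟨hmain, ⟨⟨exists_twoSidedIdeal_geometricIdeal hbg hinv, isClosed_closure,
    (unitsOf_subset_iff.2 hsub).antisymm hunits⟩, ?_⟩,
    ⟨exists_twoSidedIdeal_ghostlyIdeal hbg hinv, isClosed_ghostlyIdeal U,
    (unitsOf_subset_iff.2 subset_rfl).antisymm (hunits.trans (unitsOf_mono hsub))⟩, ?_⟩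
  · rintro _ ⟨⟨I, rfl⟩, hI, hIU⟩
    exact (hmain I hI hIU).1
  · rintro _ ⟨⟨I, rfl⟩, hI, hIU⟩
    exact (hmain I hI hIU).2
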